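/- Let $X$ be an arbitrary metric space (not assumed proper) and let $A,B\subseteq X$ be subsets with $X=A\cup B$, each regarded as a metric space with the restricted metric. Then $$\operatorname{asdim}(X)=\max\bigl(\operatorname{asdim}(A),\operatorname{asdim}(B)\bigr)$$ as an equality in $\{0,1,2,\dots\}\cup\{\infty\}$. Here the asymptotic dimension is defined as follows. For a family $\mathcal U$ of subsets of a metric space $Y$, the Lebesgue number of $\mathcal U$ is $$L(\mathcal U,Y)=\inf_{x\in Y}\ \sup_{U\in\mathcal U}\operatorname{dist}(x,Y\setminus U)\in[0,\infty],\qquad \operatorname{dist}(x,\emptyset)=\infty,$$ and the multiplicity of $\mathcal U$ is the supremum over $x\in Y$ of the number of elements of $\mathcal U$ containing $x$. A family $\mathcal V$ refines $\mathcal U$ if every element of $\mathcal V$ is contained in some element of $\mathcal U$. For an integer $n\ge 0$, $L^n(\mathcal U,Y)$ is the supremum of all $t\in[0,\infty]$ such that $\mathcal U$ has a refinement of multiplicity at most $n+1$ and Lebesgue number at least $t$. Then $\operatorname{asdim}(Y)$ is the smallest integer $n\ge 0$ such that $L^n(\mathcal U_k,Y)\to\infty$ for every sequence $(\mathcal U_k)$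 of covers of $Y$ with $L(\mathcal U_k,Y)\to\infty$, and $\operatorname{asdim}(Y)=\infty$ if there is no such $n$. -/

import Mathlib

open Filter Topology
open scoped ENNReal

namespace CoarseDim

/-- A family of sets is a cover of the whole space. -/
def IsCover {X : Type*} (𝒰 : Set (Set X)) : Prop := ⋃₀ 𝒰 = Set.univ

/-- `𝒱` refines `𝒰`: every element of `𝒱` is contained in an element of `𝒰`. -/
def Refines {X : Type*} (𝒱 𝒰 : Set (Set X)) : Prop := ∀ V ∈ 𝒱, ∃ U ∈ 𝒰, V ⊆ U

/-- The multiplicity of a family: the supremum over all points `x` of the number of elements of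
the family that contain `x`. -/
noncomputable def multiplicity {X : Type*} (𝒰 : Set (Set X)) : ℕ∞ :=
  ⨆ x : X, {U | U ∈ 𝒰 ∧ x ∈ U}.encard

/-- The local Lebesgue number of a family at `x`: the supremum over `U ∈ 𝒰` of the distance from
`x` to the complement of `U`. The distance to the empty set is `∞`, so the value is `∞` when the
whole space belongs to `𝒰`. -/
noncomputable def localLebesgueNumber {X : Type*} [PseudoMetricSpace X] (𝒰 : Set (Set X))
    (x : X) : ℝ≥0∞ :=
  ⨆ U ∈ 𝒰, Metric.infEDist x Uᶜ

/-- The Lebesgue number `L(𝒰, X)` of a family in `X`. -/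
noncomputable def lebesgueNumber {X : Type*} [PseudoMetricSpace X] (𝒰 : Set (Set X)) : ℝ≥0∞ :=
  ⨅ x : X, localLebesgueNumber 𝒰 x

/-- The `n`-th Lebesgue number `L^n(𝒰, X)`: the supremum of all `t ∈ [0, ∞]` such that `𝒰` has a
refinement of multiplicity at most `n + 1` and Lebesgue number at least `t`. -/
noncomputable def higherLebesgueNumber {X : Type*} [PseudoMetricSpace X] (n : ℕ)
    (𝒰 : Set (Set X)) : ℝ≥0∞ :=
  sSup {t : ℝ≥0∞ | ∃ 𝒱 : Set (Set X),
    Refines 𝒱 𝒰 ∧ multiplicity 𝒱 ≤ (n : ℕ∞) + 1 ∧ t ≤ lebesgueNumber 𝒱}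

/-- A `[0, ∞]`-valued function on families is coarsely proper on the space of all covers of `X`
if `f (𝒰 k) → ∞` for every sequence of covers with `𝒰 k → ∞`, where the latter
means that the Lebesgue numbers of the covers tend to `∞`. -/
def CoarselyProperOnCovers {X : Type*} [PseudoMetricSpace X] (f : Set (Set X) → ℝ≥0∞) : Prop :=
  ∀ 𝒰 : ℕ → Set (Set X), (∀ k, IsCover (𝒰 k)) →
    Tendsto (fun k => lebesgueNumber (𝒰 k)) atTop (𝓝 ∞) →
    Tendsto (fun k => f (𝒰 k)) atTop (𝓝 ∞)

/-- The asymptotic dimension of `X`: the smallest integer `n ≥ 0` such that `𝒰 ↦ L^n(𝒰, X)` is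
coarsely proper on the space of all covers of `X`, and `∞` if there is none. -/
noncomputable def asdim (X : Type*) [PseudoMetricSpace X] : ℕ∞ :=
  sInf {m : ℕ∞ | ∃ n : ℕ, m = (n : ℕ∞) ∧
    CoarselyProperOnCovers (fun 𝒰 : Set (Set X) => higherLebesgueNumber n 𝒰)}

end CoarseDim

/-!
A space has asymptotic dimension at most `n` if and only if, at every scale `r`, it is the union of
`n + 1` uniformly bounded families of pairwise `r`-distant sets.

* Given such families, thicken their members: sets of one family stay disjoint, so the multiplicity
  is at most `n + 1`, and boundedness makes the thickened sets refine every cover of large Lebesgue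
  number.
* Conversely, refine the cover by large balls to a family `𝒱` of multiplicity at most `n + 1` and
  Lebesgue number greater than `(n + 1) r`. At each point `x`, the depths of `x` in the at most
  `n + 1` members of `𝒱` containing it leave a gap of length `r` somewhere below the largest one.
  Sort the points by the finite set `F ⊆ 𝒱` of members above the gap. Points with the same `F` lie
  in a common member of `𝒱`. Depths are `1`-Lipschitz, so points with different sets `F` of the same
  cardinality are `r`-distant, and this cardinality serves as the index of the family.

In terms of these decompositions the union theorem is a construction on families: merge each
`r`-distant family on `A` into a much coarser family on `B` by adding to every set of the latter all
the sets of the former that come `r`-close to it.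
-/

namespace CoarseDim

open scoped NNReal Finset

variable {X Y ι : Type*}

section Families

variable [PseudoMetricSpace X] [PseudoMetricSpace Y]
variable {𝒰 𝒱 : Set (Set X)} {D r s : ℝ≥0} {f : X → Y}

/-- A family is `r`-disjoint if any two distinct members of it are at distance at least `r`. -/
def IsScaleDisjoint (r : ℝ≥0) (𝒰 : Set (Set X)) : Prop :=
  ∀ U ∈ 𝒰, ∀ V ∈ 𝒰, ∀ x ∈ U, ∀ y ∈ V, dist x y < r → U = V

/-- A family is `D`-bounded if all its members have diameter at most `D`. -/
def IsBoundedBy (D : ℝ≥0) (𝒰 : Set (Set X)) : Prop :=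
  ∀ U ∈ 𝒰, ∀ x ∈ U, ∀ y ∈ U, dist x y ≤ D

lemma IsScaleDisjoint.mono (h : IsScaleDisjoint s 𝒱) (hr : r ≤ s) (h𝒰 : 𝒰 ⊆ 𝒱) :
    IsScaleDisjoint r 𝒰 :=
  fun U hU V hV x hx y hy hxy =>
    h U (h𝒰 hU) V (h𝒰 hV) x hx y hy (hxy.trans_le (NNReal.coe_le_coe.2 hr))

lemma IsScaleDisjoint.image (hf : Isometry f) (h : IsScaleDisjoint r 𝒰) :
    IsScaleDisjoint r (Set.image f '' 𝒰) := by
  rintro _ ⟨U, hU, rfl⟩ _ ⟨V, hV, rfl⟩ _ ⟨x, hx, rfl⟩ _ ⟨y, hy, rfl⟩ hxy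
  rw [hf.dist_eq] at hxy
  rw [h U hU V hV x hx y hy hxy]

lemma IsBoundedBy.image (hf : Isometry f) (h : IsBoundedBy D 𝒰) :
    IsBoundedBy D (Set.image f '' 𝒰) := by
  rintro _ ⟨U, hU, rfl⟩ _ ⟨x, hx, rfl⟩ _ ⟨y, hy, rfl⟩
  exact (hf.dist_eq x y).trans_le (h U hU x hx y hy)

lemma IsScaleDisjoint.preimage (hf : Isometry f) {𝒰 : Set (Set Y)} (h : IsScaleDisjoint r 𝒰) :
    IsScaleDisjoint r (Set.preimage f '' 𝒰) := by
  rintro _ ⟨U, hU, rfl⟩ _ ⟨V, hV, rfl⟩ x hx y hy hxy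
  rw [h U hU V hV (f x) hx (f y) hy (by rwa [hf.dist_eq])]

lemma IsBoundedBy.preimage (hf : Isometry f) {𝒰 : Set (Set Y)} (h : IsBoundedBy D 𝒰) :
    IsBoundedBy D (Set.preimage f '' 𝒰) := by
  rintro _ ⟨U, hU, rfl⟩ x hx y hy
  exact (hf.dist_eq x y).symm.trans_le (h U hU (f x) hx (f y) hy)

end Families

section SaturatedUnion

variable [PseudoMetricSpace X] {𝒰 𝒱 : Set (Set X)} {U V : Set X} {D E r : ℝ≥0} {x y : X}

/-- Two sets are `r`-near if they contain points at distance less than `r` from each other. -/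
def IsNear (r : ℝ≥0) (U V : Set X) : Prop := ∃ x ∈ U, ∃ y ∈ V, dist x y < r

/-- The saturation of the set `V`: its union with all the members of `𝒰` that are `r`-near to it. -/
def saturation (r : ℝ≥0) (𝒰 : Set (Set X)) (V : Set X) : Set X :=
  V ∪ ⋃₀ {U ∈ 𝒰 | IsNear r U V}

/-- The `r`-saturated union of a family `𝒰` with a coarser family `𝒱`: the saturations of the
members of `𝒱`, together with the members of `𝒰` that are absorbed by none of them. -/
def saturatedUnion (r : ℝ≥0) (𝒰 𝒱 : Set (Set X)) : Set (Set X) :=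
  saturation r 𝒰 '' 𝒱 ∪ {U ∈ 𝒰 | ∀ V ∈ 𝒱, ¬ IsNear r U V}

lemma sUnion_union_subset_sUnion_saturatedUnion (r : ℝ≥0) (𝒰 𝒱 : Set (Set X)) :
    ⋃₀ 𝒰 ∪ ⋃₀ 𝒱 ⊆ ⋃₀ saturatedUnion r 𝒰 𝒱 := by
  rintro x (⟨U, hU, hx⟩ | ⟨V, hV, hx⟩)
  · by_cases hnear : ∃ V ∈ 𝒱, IsNear r U V
    · obtain ⟨V, hV, hUV⟩ := hnear
      exact ⟨_, Or.inl ⟨V, hV, rfl⟩, Or.inr ⟨U, ⟨hU, hUV⟩, hx⟩⟩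
    · push Not at hnear
      exact ⟨U, Or.inr ⟨hU, hnear⟩, hx⟩
  · exact ⟨_, Or.inl ⟨V, hV, rfl⟩, Or.inl hx⟩

lemma IsBoundedBy.exists_dist_le_of_mem_saturation (h𝒰 : IsBoundedBy D 𝒰)
    (hx : x ∈ saturation r 𝒰 V) : ∃ v ∈ V, dist x v ≤ D + r := by
  obtain hx | ⟨U, ⟨hU, u, hu, v, hv, huv⟩, hx⟩ := hx
  · exact ⟨x, hx, by rw [dist_self]; positivity⟩
  · exact ⟨v, hv, by linarith [dist_triangle x u v, h𝒰 U hU x hx u hu]⟩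

lemma IsBoundedBy.saturatedUnion (h𝒰 : IsBoundedBy D 𝒰) (h𝒱 : IsBoundedBy E 𝒱) :
    IsBoundedBy (E + 2 * (D + r)) (saturatedUnion r 𝒰 𝒱) := by
  rintro _ (⟨V, hV, rfl⟩ | ⟨hU, -⟩) x hx y hy <;> push_cast
  · obtain ⟨v, hv, hxv⟩ := h𝒰.exists_dist_le_of_mem_saturation hx
    obtain ⟨w, hw, hyw⟩ := h𝒰.exists_dist_le_of_mem_saturation hy
    linarith [dist_triangle4_right x y v w, h𝒱 V hV v hv w hw]
  · linarith [h𝒰 _ hU x hx y hy, D.coe_nonneg, E.coe_nonneg, r.coe_nonneg]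

lemma IsScaleDisjoint.le_dist_of_mem_saturation (h𝒰 : IsScaleDisjoint r 𝒰) (hU : U ∈ 𝒰)
    (hUV : ¬ IsNear r U V) (hx : x ∈ U) (hy : y ∈ saturation r 𝒰 V) : r ≤ dist x y := by
  by_contra! hxy
  obtain hy | ⟨U', ⟨hU', hU'V⟩, hy⟩ := hy
  · exact hUV ⟨x, hx, y, hy, hxy⟩
  · exact hUV (h𝒰 U hU U' hU' x hx y hy hxy ▸ hU'V)

lemma IsScaleDisjoint.saturatedUnion (h𝒰 : IsScaleDisjoint r 𝒰) (hD : IsBoundedBy D 𝒰)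
    (h𝒱 : IsScaleDisjoint (2 * D + 3 * r) 𝒱) : IsScaleDisjoint r (saturatedUnion r 𝒰 𝒱) := by
  rintro _ (⟨V, hV, rfl⟩ | ⟨hU, hUV⟩) _ (⟨V', hV', rfl⟩ | ⟨hU', hU'V⟩) x hx y hy hxy
  · obtain ⟨v, hv, hxv⟩ := hD.exists_dist_le_of_mem_saturation hx
    obtain ⟨v', hv', hyv'⟩ := hD.exists_dist_le_of_mem_saturation hy
    have hvv' : dist v v' < 2 * D + 3 * r := by linarith [dist_triangle4_left x y v v']
    rw [h𝒱 V hV V' hV' v hv v' hv' (mod_cast hvv')]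
  · rw [dist_comm] at hxy
    exact absurd hxy (h𝒰.le_dist_of_mem_saturation hU' (hU'V V hV) hy hx).not_gt
  · exact absurd hxy (h𝒰.le_dist_of_mem_saturation hU (hUV V' hV') hx hy).not_gt
  · exact h𝒰 _ hU _ hU' x hx y hy hxy

end SaturatedUnion

section ColorDecomposable

variable [PseudoMetricSpace X] [PseudoMetricSpace Y] {n : ℕ} {A B : Set X} {f : X → Y}

/-- At every scale `r`, the set `A` is covered by `n + 1` uniformly bounded `r`-disjoint families.
The families consist of subsets of the ambient space that need not be contained in `A`. -/
def ColorDecomposable (n : ℕ) (A : Set X) : Prop :=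
  ∀ r : ℝ≥0, ∃ (D : ℝ≥0) (𝒰 : Fin (n + 1) → Set (Set X)),
    (∀ i, IsScaleDisjoint r (𝒰 i)) ∧ (∀ i, IsBoundedBy D (𝒰 i)) ∧ A ⊆ ⋃ i, ⋃₀ 𝒰 i

lemma ColorDecomposable.mono (hB : ColorDecomposable n B) (hAB : A ⊆ B) :
    ColorDecomposable n A := fun r =>
  let ⟨D, 𝒰, hdisj, hbdd, hcov⟩ := hB r
  ⟨D, 𝒰, hdisj, hbdd, hAB.trans hcov⟩

lemma ColorDecomposable.union (hA : ColorDecomposable n A) (hB : ColorDecomposable n B) :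
    ColorDecomposable n (A ∪ B) := by
  intro r
  obtain ⟨D, 𝒰, h𝒰, hD, hA⟩ := hA r
  obtain ⟨E, 𝒱, h𝒱, hE, hB⟩ := hB (2 * D + 3 * r)
  refine ⟨E + 2 * (D + r), fun i => saturatedUnion r (𝒰 i) (𝒱 i),
    fun i => (h𝒰 i).saturatedUnion (hD i) (h𝒱 i), fun i => (hD i).saturatedUnion (hE i), ?_⟩
  calc A ∪ B ⊆ (⋃ i, ⋃₀ 𝒰 i) ∪ ⋃ i, ⋃₀ 𝒱 i := Set.union_subset_union hA hB
    _ = ⋃ i, (⋃₀ 𝒰 i ∪ ⋃₀ 𝒱 i) := Set.iUnion_union_distrib _ _ |>.symm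
    _ ⊆ ⋃ i, ⋃₀ saturatedUnion r (𝒰 i) (𝒱 i) :=
      Set.iUnion_mono fun i => sUnion_union_subset_sUnion_saturatedUnion r (𝒰 i) (𝒱 i)

lemma colorDecomposable_union_iff :
    ColorDecomposable n (A ∪ B) ↔ ColorDecomposable n A ∧ ColorDecomposable n B :=
  ⟨fun h => ⟨h.mono Set.subset_union_left, h.mono Set.subset_union_right⟩,
    fun h => h.1.union h.2⟩

lemma colorDecomposable_image_iff (hf : Isometry f) :
    ColorDecomposable n (f '' A) ↔ ColorDecomposable n A := by
  refine ⟨fun h r => ?_, fun h r => ?_⟩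
  · obtain ⟨D, 𝒰, hdisj, hbdd, hcov⟩ := h r
    refine ⟨D, fun i => Set.preimage f '' 𝒰 i, fun i => (hdisj i).preimage hf,
      fun i => (hbdd i).preimage hf, ?_⟩
    simpa only [Set.image_subset_iff, Set.preimage_iUnion, Set.preimage_sUnion, Set.sUnion_image]
      using hcov
  · obtain ⟨D, 𝒰, hdisj, hbdd, hcov⟩ := h r
    refine ⟨D, fun i => Set.image f '' 𝒰 i, fun i => (hdisj i).image hf,
      fun i => (hbdd i).image hf, ?_⟩
    simpa only [Set.image_iUnion, Set.image_sUnion] using Set.image_mono hcov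

end ColorDecomposable

section LebesgueNumber

variable [PseudoMetricSpace X] {𝒰 : Set (Set X)} {U : Set X} {s : ℝ≥0} {x : X}

lemma coe_le_infEDist_compl_iff : (s : ℝ≥0∞) ≤ Metric.infEDist x Uᶜ ↔ Metric.ball x s ⊆ U := by
  simp only [Metric.le_infEDist, ← Metric.eball_coe, Set.subset_def, Metric.mem_eball',
    Set.mem_compl_iff]
  exact forall_congr' fun y => by rw [← not_lt, not_imp_not]

lemma coe_le_lebesgueNumber (h : ∀ x, ∃ U ∈ 𝒰, Metric.ball x s ⊆ U) :
    (s : ℝ≥0∞) ≤ lebesgueNumber 𝒰 :=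
  le_iInf fun x =>
    let ⟨U, hU, hxU⟩ := h x
    le_iSup₂_of_le U hU (coe_le_infEDist_compl_iff.2 hxU)

lemma exists_ball_subset_of_lt_lebesgueNumber (h : s < lebesgueNumber 𝒰) (x : X) :
    ∃ U ∈ 𝒰, Metric.ball x s ⊆ U := by
  have hx : s < localLebesgueNumber 𝒰 x := h.trans_le (iInf_le _ x)
  simp only [localLebesgueNumber, lt_iSup_iff, exists_prop] at hx
  obtain ⟨U, hU, hlt⟩ := hx
  exact ⟨U, hU, coe_le_infEDist_compl_iff.1 hlt.le⟩

lemma higherLebesgueNumber_mono (𝒰 : Set (Set X)) :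
    Monotone fun n => higherLebesgueNumber n 𝒰 :=
  fun m n hmn => sSup_le_sSup fun _ ⟨𝒱, href, hmul, ht⟩ =>
    ⟨𝒱, href, hmul.trans (by gcongr), ht⟩

lemma asdim_le_iff_coarselyProper {n : ℕ} :
    asdim X ≤ n ↔ CoarselyProperOnCovers (X := X) (higherLebesgueNumber n) := by
  refine ⟨fun h => ?_, fun h => sInf_le ⟨n, rfl, h⟩⟩
  obtain ⟨_, ⟨m, rfl, hm⟩, hmn⟩ := sInf_lt_iff.1 (ENat.lt_natCast_add_one_iff.2 h)
  have hmn : m ≤ n := mod_cast ENat.lt_natCast_add_one_iff.1 hmn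
  exact fun 𝒰 hcov hL => tendsto_nhds_top_mono' (hm 𝒰 hcov hL)
    fun k => higherLebesgueNumber_mono (𝒰 k) hmn

end LebesgueNumber

section Thickening

lemma multiplicity_iUnion_le [Fintype ι] (𝒰 : ι → Set (Set X)) :
    multiplicity (⋃ i, 𝒰 i) ≤ ∑ i, multiplicity (𝒰 i) := by
  refine iSup_le fun x => ?_
  calc {U | U ∈ ⋃ i, 𝒰 i ∧ x ∈ U}.encard = (⋃ i, {U | U ∈ 𝒰 i ∧ x ∈ U}).encard := by
        congr 1; ext U; simp
    _ ≤ ∑ i, {U | U ∈ 𝒰 i ∧ x ∈ U}.encard := Set.encard_iUnion_le_of_fintype _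
    _ ≤ ∑ i, multiplicity (𝒰 i) :=
      Finset.sum_le_sum fun i _ => le_iSup (fun x => {U | U ∈ 𝒰 i ∧ x ∈ U}.encard) x

variable [PseudoMetricSpace X] {n : ℕ} {D s : ℝ≥0}

lemma IsScaleDisjoint.multiplicity_thickening_le_one {𝒰 : Set (Set X)}
    (h : IsScaleDisjoint (2 * s) 𝒰) : multiplicity (Metric.thickening s '' 𝒰) ≤ 1 := by
  refine iSup_le fun x => Set.encard_le_one_iff.2 ?_
  rintro _ _ ⟨⟨U, hU, rfl⟩, hxU⟩ ⟨⟨V, hV, rfl⟩, hxV⟩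
  obtain ⟨u, hu, hxu⟩ := Metric.mem_thickening_iff.1 hxU
  obtain ⟨v, hv, hxv⟩ := Metric.mem_thickening_iff.1 hxV
  have huv : dist u v < 2 * s := by linarith [dist_triangle_left u v x]
  rw [h U hU V hV u hu v hv (mod_cast huv)]

lemma IsBoundedBy.thickening_subset_ball {𝒰 : Set (Set X)} (h : IsBoundedBy D 𝒰) {U : Set X}
    (hU : U ∈ 𝒰) {x : X} (hx : x ∈ U) : Metric.thickening s U ⊆ Metric.ball x (D + s) := by
  intro y hy
  obtain ⟨u, hu, hyu⟩ := Metric.mem_thickening_iff.1 hy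
  exact Metric.mem_ball.2 (by linarith [dist_triangle y u x, h U hU u hu x hx])

lemma coe_le_higherLebesgueNumber {𝒰 : Fin (n + 1) → Set (Set X)} {𝒲 : Set (Set X)}
    (hdisj : ∀ i, IsScaleDisjoint (2 * s) (𝒰 i)) (hbdd : ∀ i, IsBoundedBy D (𝒰 i))
    (hcov : Set.univ ⊆ ⋃ i, ⋃₀ 𝒰 i) (h𝒲 : ↑(D + s) < lebesgueNumber 𝒲) :
    s ≤ higherLebesgueNumber n 𝒲 := by
  -- Empty members have to go: if `X` is empty, then so may be `𝒲`.
  let 𝒱 i := Metric.thickening s '' {U ∈ 𝒰 i | U.Nonempty}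
  refine le_sSup ⟨⋃ i, 𝒱 i, fun V hV => ?refines, ?multiplicity,
    coe_le_lebesgueNumber fun x => ?lebesgue⟩
  case refines =>
    obtain ⟨i, U, ⟨hU, x, hx⟩, rfl⟩ := Set.mem_iUnion.1 hV
    obtain ⟨W, hW, hxW⟩ := exists_ball_subset_of_lt_lebesgueNumber h𝒲 x
    exact ⟨W, hW, ((hbdd i).thickening_subset_ball hU hx).trans hxW⟩
  case multiplicity =>
    calc multiplicity (⋃ i, 𝒱 i) ≤ ∑ i, multiplicity (𝒱 i) := multiplicity_iUnion_le 𝒱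
      _ ≤ ∑ _ : Fin (n + 1), 1 := Finset.sum_le_sum fun i _ =>
        ((hdisj i).mono le_rfl (Set.sep_subset _ _)).multiplicity_thickening_le_one
      _ = n + 1 := by simp
  case lebesgue =>
    obtain ⟨i, U, hU, hx⟩ := Set.mem_iUnion.1 (hcov (Set.mem_univ x))
    exact ⟨_, Set.mem_iUnion.2 ⟨i, U, ⟨hU, x, hx⟩, rfl⟩, Metric.ball_subset_thickening hx s⟩

lemma ColorDecomposable.coarselyProper (h : ColorDecomposable n (Set.univ : Set X)) :
    CoarselyProperOnCovers (X := X) (higherLebesgueNumber n) := by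
  intro 𝒲 _ h𝒲
  rw [ENNReal.tendsto_nhds_top_iff_nnreal]
  intro t
  obtain ⟨D, 𝒰, hdisj, hbdd, hcov⟩ := h (2 * (t + 1))
  filter_upwards [h𝒲.eventually (lt_mem_nhds ENNReal.coe_lt_top)] with k hk
  have ht : (t : ℝ≥0∞) < ↑(t + 1) := ENNReal.coe_lt_coe.2 (lt_add_one t)
  exact ht.trans_le (coe_le_higherLebesgueNumber hdisj hbdd hcov hk)

end Thickening

section DominanceSet

/-- Pigeonhole: the `#S - 1` values other than `f a` miss one of the `#S` intervals
`(k * r, (k + 1) * r)`, `k < #S`. -/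
lemma exists_gap {S : Finset ι} {f : ι → ℝ} {r : ℝ} (hr : 0 < r) {a : ι} (ha : a ∈ S)
    (hfa : #S * r ≤ f a) :
    ∃ k : ℕ, (k + 1) * r ≤ f a ∧ ∀ b ∈ S, f b ≤ k * r ∨ (k + 1) * r ≤ f b := by
  classical
  let level b := ⌊f b / r⌋₊
  have hcard : #((S.erase a).image level) < #(Finset.range #S) :=
    Finset.card_image_le.trans_lt (by simpa using Finset.card_erase_lt_of_mem ha)
  obtain ⟨k, hkS, hk⟩ := Finset.exists_mem_notMem_of_card_lt_card hcard
  have hka : (k + 1) * r ≤ f a := by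
    have hkS : (k : ℝ) + 1 ≤ #S := mod_cast Finset.mem_range.1 hkS
    exact (mul_le_mul_of_nonneg_right hkS hr.le).trans hfa
  refine ⟨k, hka, fun b hb => ?_⟩
  by_cases hba : b = a
  · exact Or.inr (hba ▸ hka)
  have hbk : level b ≠ k := fun h =>
    hk (Finset.mem_image.2 ⟨b, Finset.mem_erase.2 ⟨hba, hb⟩, h⟩)
  obtain hlt | hgt := hbk.lt_or_gt
  · exact Or.inl ((div_lt_iff₀ hr).1 (Nat.lt_of_floor_lt hlt)).le
  · have hkb : ((k + 1 : ℕ) : ℝ) ≤ f b / r := (Nat.le_floor_iff' k.succ_ne_zero).1 hgt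
    exact Or.inr (by simpa using (le_div_iff₀ hr).1 hkb)

variable {φ : ι → X → ℝ} {r : ℝ≥0} {F : Finset ι} {x y : X}

/-- The points at which every `φ a` with `a ∈ F` exceeds by at least `r` both `0` and all the
functions whose index is not in `F`. -/
def dominanceSet (φ : ι → X → ℝ) (r : ℝ≥0) (F : Finset ι) : Set X :=
  {x | ∀ a ∈ F, r ≤ φ a x ∧ ∀ b ∉ F, φ b x + r ≤ φ a x}

lemma exists_mem_dominanceSet (hr : 0 < r) {S : Finset ι} (hS : ∀ b ∉ S, φ b x ≤ 0) {a : ι}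
    (ha : a ∈ S) (hφ : #S * r ≤ φ a x) : ∃ F ⊆ S, F.Nonempty ∧ x ∈ dominanceSet φ r F := by
  obtain ⟨k, hka, hgap⟩ := exists_gap (f := fun b => φ b x) (NNReal.coe_pos.2 hr) ha hφ
  have hkr : (0 : ℝ) ≤ k * r := by positivity
  refine ⟨{b ∈ S | (k + 1) * r ≤ φ b x}, Finset.filter_subset _ _,
    ⟨a, Finset.mem_filter.2 ⟨ha, hka⟩⟩, fun c hc => ?_⟩
  have hkc := (Finset.mem_filter.1 hc).2
  refine ⟨by linarith, fun b hb => ?_⟩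
  have hbk : φ b x ≤ k * r := by
    by_cases hbS : b ∈ S
    · exact (hgap b hbS).resolve_right fun h => hb (Finset.mem_filter.2 ⟨hbS, h⟩)
    · exact (hS b hbS).trans hkr
  linarith

lemma isScaleDisjoint_dominanceSet [PseudoMetricSpace X] (hφ : ∀ a, LipschitzWith 1 (φ a))
    (r : ℝ≥0) (k : ℕ) : IsScaleDisjoint r (dominanceSet φ r '' {F | #F = k}) := by
  rintro _ ⟨F, hF, rfl⟩ _ ⟨G, hG, rfl⟩ x hx y hy hxy
  by_contra hne
  have hFG : F ≠ G := fun h => hne (congrArg _ h)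
  obtain ⟨a, haF, haG⟩ := Finset.not_subset.1 fun h =>
    hFG (Finset.eq_of_subset_of_card_le h (hG.trans hF.symm).le)
  obtain ⟨b, hbG, hbF⟩ := Finset.not_subset.1 fun h =>
    hFG (Finset.eq_of_subset_of_card_le h (hF.trans hG.symm).le).symm
  have hab_x : φ b x + r ≤ φ a x := (hx a haF).2 b hbF
  have hab_y : φ a y + r ≤ φ b y := (hy b hbG).2 a haG
  have ha : φ a x ≤ φ a y + dist x y := by simpa using (hφ a).le_add_mul x y
  have hb : φ b y ≤ φ b x + dist x y := by simpa [dist_comm] using (hφ b).le_add_mul y x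
  linarith

end DominanceSet

section Depth

variable [PseudoMetricSpace X] {M : ℝ≥0} {V : Set X} {x : X}

/-- The depth of `x` in `V`: its distance to the complement of `V`, truncated at `M` so as to be
finite even if `V` is the whole space. -/
noncomputable def depth (M : ℝ≥0) (V : Set X) (x : X) : ℝ :=
  (min (Metric.infEDist x Vᶜ) M).toReal

lemma lipschitzWith_depth (M : ℝ≥0) (V : Set X) : LipschitzWith 1 (depth M V) := by
  refine LipschitzWith.of_le_add fun x y => ?_
  have hfin : min (Metric.infEDist y Vᶜ) M ≠ ∞ :=
    ne_top_of_le_ne_top ENNReal.coe_ne_top (min_le_right _ _)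
  rw [depth, depth, dist_edist, ← ENNReal.toReal_add hfin (edist_ne_top _ _)]
  refine ENNReal.toReal_mono (ENNReal.add_ne_top.2 ⟨hfin, edist_ne_top _ _⟩) ?_
  rw [min_add]
  exact min_le_min Metric.infEDist_le_infEDist_add_edist le_self_add

lemma depth_of_notMem (M : ℝ≥0) (hx : x ∉ V) : depth M V x = 0 := by
  simp [depth, Metric.infEDist_zero_of_mem (Set.mem_compl hx)]

lemma depth_of_ball_subset (h : Metric.ball x M ⊆ V) : depth M V x = M := by
  rw [depth, min_eq_right (coe_le_infEDist_compl_iff.2 h), ENNReal.coe_toReal]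

end Depth

section OfCoarselyProper

lemma exists_finset_of_multiplicity_le {𝒱 : Set (Set X)} {m : ℕ} (h : multiplicity 𝒱 ≤ m)
    (x : X) : ∃ S : Finset 𝒱, #S ≤ m ∧ ∀ V : 𝒱, V ∈ S ↔ x ∈ V.1 := by
  have himage : Subtype.val '' {V : 𝒱 | x ∈ V.1} = {V | V ∈ 𝒱 ∧ x ∈ V} := by
    ext V; simp [and_comm]
  have hcard : {V : 𝒱 | x ∈ V.1}.encard ≤ m := by
    rw [← Subtype.val_injective.encard_image, himage]
    exact (le_iSup (fun x => {V | V ∈ 𝒱 ∧ x ∈ V}.encard) x).trans h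
  have hfin := Set.finite_of_encard_le_coe hcard
  rw [hfin.encard_eq_coe_toFinset_card] at hcard
  exact ⟨hfin.toFinset, mod_cast hcard, fun V => by simp⟩

variable [PseudoMetricSpace X] {𝒱 : Set (Set X)} {D r : ℝ≥0} {n : ℕ}

lemma isBoundedBy_dominanceSet_depth (h𝒱 : IsBoundedBy D 𝒱) (M : ℝ≥0) (hr : 0 < r) (k : ℕ) :
    IsBoundedBy D (dominanceSet (fun V : 𝒱 => depth M V.1) r '' {F | #F = k + 1}) := by
  rintro _ ⟨F, hF, rfl⟩ x hx y hy
  obtain ⟨V, hV⟩ : F.Nonempty := Finset.card_pos.1 (hF ▸ k.succ_pos)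
  have mem_of_mem : ∀ z ∈ dominanceSet (fun V : 𝒱 => depth M V.1) r F, z ∈ V.1 := by
    intro z hz
    by_contra hzV
    have hrz : r ≤ depth M V.1 z := (hz V hV).1
    rw [depth_of_notMem M hzV] at hrz
    exact hrz.not_gt (NNReal.coe_pos.2 hr)
  exact h𝒱 V V.2 x (mem_of_mem x hx) y (mem_of_mem y hy)

lemma univ_subset_iUnion_dominanceSet_depth (hr : 0 < r) (hmul : multiplicity 𝒱 ≤ n + 1)
    (hL : ↑((n + 1) * r) < lebesgueNumber 𝒱) :
    Set.univ ⊆ ⋃ i : Fin (n + 1),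
      ⋃₀ (dominanceSet (fun V : 𝒱 => depth ((n + 1) * r) V.1) r '' {F | #F = i + 1}) := by
  intro x _
  obtain ⟨S, hScard, hS⟩ := exists_finset_of_multiplicity_le (m := n + 1) (mod_cast hmul) x
  obtain ⟨V, hV, hxV⟩ := exists_ball_subset_of_lt_lebesgueNumber hL x
  have hx : x ∈ V := hxV (Metric.mem_ball_self (by positivity))
  have hdepth : #S * r ≤ depth ((n + 1) * r) V x := by
    rw [depth_of_ball_subset hxV]
    exact_mod_cast mul_le_mul_of_nonneg_right (Nat.cast_le.2 hScard) r.2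
  obtain ⟨F, hFS, hF, hxF⟩ := exists_mem_dominanceSet (φ := fun V : 𝒱 => depth ((n + 1) * r) V.1)
    hr (fun W hW => (depth_of_notMem _ (mt (hS W).2 hW)).le) ((hS ⟨V, hV⟩).2 hx) hdepth
  have hFcard : #F ≤ n + 1 := (Finset.card_le_card hFS).trans hScard
  exact Set.mem_iUnion.2
    ⟨⟨#F - 1, by lia⟩, _, ⟨F, (Nat.sub_add_cancel hF.card_pos).symm, rfl⟩, hxF⟩

lemma CoarselyProperOnCovers.exists_isBoundedBy
    (h : CoarselyProperOnCovers (X := X) (higherLebesgueNumber n)) (t : ℝ≥0) :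
    ∃ (D : ℝ≥0) (𝒱 : Set (Set X)),
      IsBoundedBy D 𝒱 ∧ multiplicity 𝒱 ≤ n + 1 ∧ t < lebesgueNumber 𝒱 := by
  let balls (k : ℕ) : Set (Set X) := Set.range fun x => Metric.ball x (k + 1 : ℝ≥0)
  have hcov k : IsCover (balls k) := Set.eq_univ_of_forall fun x =>
    ⟨_, ⟨x, rfl⟩, Metric.mem_ball_self (by positivity)⟩
  have hL (k : ℕ) : (k : ℝ≥0∞) ≤ lebesgueNumber (balls k) := calc
    (k : ℝ≥0∞) ≤ ↑(k + 1 : ℝ≥0) := by simp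
    _ ≤ lebesgueNumber (balls k) := coe_le_lebesgueNumber fun x => ⟨_, ⟨x, rfl⟩, subset_rfl⟩
  have hlim := h balls hcov (tendsto_nhds_top_mono' ENNReal.tendsto_nat_nhds_top hL)
  obtain ⟨k, hk⟩ := (hlim.eventually (lt_mem_nhds (ENNReal.coe_lt_top (r := t)))).exists
  obtain ⟨t', ⟨𝒱, href, hmul, ht'⟩, ht⟩ := lt_sSup_iff.1 hk
  refine ⟨2 * (k + 1), 𝒱, fun V hV x hx y hy => ?_, hmul, ht.trans_le ht'⟩
  obtain ⟨_, ⟨z, rfl⟩, hVz⟩ := href V hV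
  have hxz := Metric.mem_ball.1 (hVz hx)
  have hyz := Metric.mem_ball.1 (hVz hy)
  push_cast at hxz hyz ⊢
  linarith [dist_triangle_right x y z]

lemma CoarselyProperOnCovers.colorDecomposable
    (h : CoarselyProperOnCovers (X := X) (higherLebesgueNumber n)) :
    ColorDecomposable n (Set.univ : Set X) := by
  intro r
  have hr : 0 < r + 1 := by positivity
  obtain ⟨D, 𝒱, hbdd, hmul, hL⟩ := h.exists_isBoundedBy ((n + 1) * (r + 1))
  exact ⟨D, _, fun i => (isScaleDisjoint_dominanceSet (fun _ => lipschitzWith_depth _ _)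
      (r + 1) (i + 1)).mono le_self_add subset_rfl,
    fun i => isBoundedBy_dominanceSet_depth hbdd _ hr i,
    univ_subset_iUnion_dominanceSet_depth hr hmul hL⟩

end OfCoarselyProper

section Asdim

variable [PseudoMetricSpace X] {n : ℕ}

theorem asdim_le_iff_colorDecomposable_univ :
    asdim X ≤ n ↔ ColorDecomposable n (Set.univ : Set X) :=
  asdim_le_iff_coarselyProper.trans
    ⟨CoarselyProperOnCovers.colorDecomposable, ColorDecomposable.coarselyProper⟩

theorem asdim_coe_le_iff_colorDecomposable {A : Set X} :
    asdim A ≤ n ↔ ColorDecomposable n A := by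
  rw [asdim_le_iff_colorDecomposable_univ, ← colorDecomposable_image_iff isometry_subtype_coe,
    Set.image_univ, Subtype.range_coe]

end Asdim

end CoarseDim

theorem mainTheorem9_general {X : Type*} [PseudoMetricSpace X] (A B : Set X)
    (hAB : A ∪ B = Set.univ) :
    CoarseDim.asdim X = max (CoarseDim.asdim A) (CoarseDim.asdim B) := by
  refine eq_of_forall_ge_iff fun n => ?_
  cases n with
  | top => simp
  | coe n =>
    rw [max_le_iff, CoarseDim.asdim_coe_le_iff_colorDecomposable,
      CoarseDim.asdim_coe_le_iff_colorDecomposable, ← CoarseDim.colorDecomposable_union_iff, hAB,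
      CoarseDim.asdim_le_iff_colorDecomposable_univ]

theorem mainTheorem9 {X : Type*} [MetricSpace X] (A B : Set X) (hAB : A ∪ B = Set.univ) :
    CoarseDim.asdim X = max (CoarseDim.asdim A) (CoarseDim.asdim B) :=
  mainTheorem9_general A B hAB
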